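/- Let $n$ be a natural number, let $\tau>0$ and $\delta\in(0,1)$ be real numbers, and put $$M=\max\left(\frac{n(1+\tau)}{(\tau\delta)^2},\,n\right).$$ Suppose that $n\ge 5\lceil\log_2 M\rceil+25$, and let $S\subseteq\mathbb{F}_2^n$ satisfy $$|S|>2^{20}\max\left(\frac{n^4(1+\tau)^4}{(\tau\delta)^8},\,n^4\right).$$ Then there is a natural number $t\le n$ with $$t\ge \log_2|S|-4\log_2 M-20$$ such that at least a $(1-\delta)$-fraction of all surjective $\mathbb{F}_2$-linear maps $L:\mathbb{F}_2^n\to\mathbb{F}_2^t$ have the following property: if $U_S$ is uniformly distributed on $S$, then $L(U_S)$ is $\tau 2^{-t}$-close to uniform in the $\ell_\infty$ norm, that is, $$\left|\Pr[L(U_S)=y]-2^{-t}\right|\le\tau 2^{-t}\qquad\text{for every } y\in\mathbb{F}_2^t.$$ -/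

import Mathlib

/-- The probability distribution `p` on the finite set `Y` is `ε`-close to the uniform
distribution in the `ℓ_∞` norm: `|p(y) - 1/|Y|| ≤ ε` for every `y`. -/
def IsLinftyCloseToUniform {Y : Type*} [Fintype Y] (p : PMF Y) (ε : ℝ) : Prop :=
  ∀ y : Y, |(p y).toReal - 1 / (Fintype.card Y : ℝ)| ≤ ε

/-- The distribution of `L(U_S)`, where `U_S` is uniformly distributed on the nonempty
finite set `S`. -/
noncomputable def imageOfUniform {X Y : Type*} (S : Finset X) (hS : S.Nonempty) (L : X → Y) :
    PMF Y :=
  (PMF.uniformOfFinset S hS).map L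

/-- The set of surjective `𝔽₂`-linear maps `𝔽₂ⁿ → 𝔽₂ᵗ`. -/
def surjectiveLinearMaps (n t : ℕ) : Set ((Fin n → ZMod 2) →ₗ[ZMod 2] (Fin t → ZMod 2)) :=
  {L | Function.Surjective L}

/-- The fraction of the surjective `𝔽₂`-linear maps `𝔽₂ⁿ → 𝔽₂ᵗ` that satisfy `P`
(meaningful when `t ≤ n`, that is, when there are such maps). -/
noncomputable def fractionOfSurjective (n t : ℕ)
    (P : ((Fin n → ZMod 2) →ₗ[ZMod 2] (Fin t → ZMod 2)) → Prop) : ℝ :=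
  ({L ∈ surjectiveLinearMaps n t | P L}.ncard : ℝ) / ((surjectiveLinearMaps n t).ncard : ℝ)

open Finset

/-! Let `K = |S| / 2^t` be the mean bucket size. Pairwise independence bounds the second moment of
the bucket sizes, but Chebyshev with a union bound over buckets loses a factor `2^t`.

To avoid this, draw an auxiliary map `L'` into `𝔽₂^k`, with `Q = 2^k` between `n` and `2n`. If `L`
has a deviating bucket `y`, then for at least half of all `L'` every one of the `Q` pieces `{L = y,
L' = z}` deviates from `K / Q` (`card_le_two_mul_card_small_deviation`): one bad bucket becomes a
full column of bad pieces. The shear `(L, L') ↦ (L - T L', L')` permutes the pairs and turns the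
column into the points `(y + T z, z)`. For random `T`, a sparse bad set rarely contains all of these
for some `y`: `card_exists_translate_le` bounds the probability by twice the sum of the slice
densities, provided `2^t ≤ 2^(2^k)`. The second moment bounds those densities on average.

This gives failure probability at most `16 Q² / (τ² K)` (`card_deviating_linearMap_le`), free of
`2^t`. The choice of `t` makes it at most `δ / 2`, and at least half of all maps are surjective. -/

/-! ### Equidistribution and second moments of random linear maps -/

theorem card_ker_mul_card_of_surjective {R A B : Type*} [Ring R] [AddCommGroup A] [Module R A]
    [AddCommGroup B] [Module R B] (e : A →ₗ[R] B) (he : Function.Surjective e) :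
    Nat.card (LinearMap.ker e) * Nat.card B = Nat.card A := by
  rw [Submodule.card_eq_card_quotient_mul_card (LinearMap.ker e),
    Nat.card_congr (e.quotKerEquivOfSurjective he).toEquiv]

/-- Evaluation at a nonzero vector is equidistributed over all linear maps. -/
theorem card_linearMap_eval_eq_zero {F V Y : Type*} [Field F] [AddCommGroup V] [Module F V]
    [AddCommGroup Y] [Module F Y] {x : V} (hx : x ≠ 0) :
    Nat.card {L : V →ₗ[F] Y // L x = 0} * Nat.card Y = Nat.card (V →ₗ[F] Y) := by
  refine card_ker_mul_card_of_surjective (LinearMap.applyₗ x : (V →ₗ[F] Y) →ₗ[F] Y) fun y => ?_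
  obtain ⟨φ, hφ⟩ := Module.Projective.exists_dual_ne_zero F hx
  refine ⟨(LinearMap.toSpanSingleton F Y ((φ x)⁻¹ • y)) ∘ₗ φ, ?_⟩
  simp [smul_smul, hφ]

/-- Composition with a nonzero functional is equidistributed over all linear maps. -/
theorem card_linearMap_dual_comp_eq_zero {F V Y : Type*} [Field F] [AddCommGroup V] [Module F V]
    [AddCommGroup Y] [Module F Y] {φ : Module.Dual F Y} (hφ : φ ≠ 0) :
    Nat.card {L : V →ₗ[F] Y // φ ∘ₗ L = 0} * Nat.card (Module.Dual F V) =
      Nat.card (V →ₗ[F] Y) := by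
  refine card_ker_mul_card_of_surjective
    (LinearMap.compRight F φ : (V →ₗ[F] Y) →ₗ[F] Module.Dual F V) fun ψ => ?_
  obtain ⟨y, hy⟩ := DFunLike.ne_iff.1 hφ
  refine ⟨(LinearMap.toSpanSingleton F Y ((φ y)⁻¹ • y)) ∘ₗ ψ, ?_⟩
  ext x
  have hy' : φ y ≠ 0 := hy
  simp [hy']

theorem sum_sq_card_fiber {X Y : Type*} [DecidableEq X] [Fintype Y] [DecidableEq Y]
    (S : Finset X) (g : X → Y) :
    ∑ y, (#{x ∈ S | g x = y} : ℝ) ^ 2 = ∑ x ∈ S, ∑ x' ∈ S, if g x = g x' then (1 : ℝ) else 0 := by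
  have h : ∀ y, (#{x ∈ S | g x = y} : ℝ) ^ 2 =
      ∑ x ∈ S, ∑ x' ∈ S, if g x = y then (if g x' = y then (1 : ℝ) else 0) else 0 := by
    intro y
    rw [card_filter, sq]
    push_cast
    rw [sum_mul_sum]
    refine sum_congr rfl fun x _ => sum_congr rfl fun x' _ => ?_
    split_ifs <;> simp
  simp_rw [h]
  rw [sum_comm]
  refine sum_congr rfl fun x _ => ?_
  rw [sum_comm]
  refine sum_congr rfl fun x' _ => ?_
  simp [eq_comm]

theorem sum_card_fiber {X Y : Type*} [Fintype Y] [DecidableEq Y]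
    (S : Finset X) (g : X → Y) : ∑ y, (#{x ∈ S | g x = y} : ℝ) = #S := by
  exact_mod_cast (card_eq_sum_card_fiberwise (f := g) (s := S) (t := univ) (by simp)).symm

/-- The second moment of the bucket sizes of a uniformly random linear map. -/
theorem sum_linearMap_sum_sq_deviation_le {F V Y : Type*} [Field F] [AddCommGroup V] [Module F V]
    [AddCommGroup Y] [Module F Y] [Fintype Y] [DecidableEq Y] [Fintype (V →ₗ[F] Y)]
    (S : Finset V) :
    ∑ L : V →ₗ[F] Y, ∑ y, ((#{x ∈ S | L x = y} : ℝ) - #S / Fintype.card Y) ^ 2 ≤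
      Fintype.card (V →ₗ[F] Y) * #S := by
  classical
  set H : ℝ := ((Fintype.card (V →ₗ[F] Y) : ℕ) : ℝ) with hH
  have hY : (0 : ℝ) < Fintype.card Y := by exact_mod_cast Fintype.card_pos
  have h1 : ∀ L : V →ₗ[F] Y, ∑ y, ((#{x ∈ S | L x = y} : ℝ) - #S / Fintype.card Y) ^ 2 =
      (∑ x ∈ S, ∑ x' ∈ S, if L x = L x' then (1 : ℝ) else 0) - (#S : ℝ) ^ 2 / Fintype.card Y := by
    intro L
    rw [← sum_sq_card_fiber]
    simp_rw [sub_sq]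
    rw [sum_add_distrib, sum_sub_distrib, ← sum_mul, ← mul_sum, sum_card_fiber]
    simp only [sum_const, card_univ, nsmul_eq_mul]
    field_simp
    ring
  have h2 : ∀ x x' : V, (∑ L : V →ₗ[F] Y, if L x = L x' then (1 : ℝ) else 0) ≤
      (if x = x' then H else 0) + H / Fintype.card Y := by
    intro x x'
    split_ifs with h
    · subst h
      simp only [if_true, sum_const, card_univ, nsmul_eq_mul, mul_one]
      have : 0 ≤ H / Fintype.card Y := by positivity
      linarith
    · have := card_linearMap_eval_eq_zero (F := F) (Y := Y) (sub_ne_zero.2 h)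
      rw [sum_boole, zero_add, le_div_iff₀ hY, hH]
      have h3 : #{L : V →ₗ[F] Y | L x = L x'} = Nat.card {L : V →ₗ[F] Y // L (x - x') = 0} := by
        rw [Nat.card_eq_fintype_card, Fintype.card_subtype]
        simp [sub_eq_zero]
      rw [h3]
      simp only [Nat.card_eq_fintype_card] at this ⊢
      exact_mod_cast this.le
  simp_rw [h1]
  rw [sum_sub_distrib, sum_comm]
  have h3 : ∑ x ∈ S, ∑ L : V →ₗ[F] Y, ∑ x' ∈ S, (if L x = L x' then (1 : ℝ) else 0) ≤
      ∑ x ∈ S, ∑ x' ∈ S, ((if x = x' then H else 0) + H / Fintype.card Y) := by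
    refine sum_le_sum fun x _ => ?_
    rw [sum_comm]
    exact sum_le_sum fun x' _ => h2 x x'
  have h4 : ∑ x ∈ S, ∑ x' ∈ S, ((if x = x' then H else 0) + H / Fintype.card Y) =
      H * #S + #S ^ 2 * H / Fintype.card Y := by
    simp only [sum_add_distrib, sum_ite_eq, sum_const, nsmul_eq_mul]
    rw [sum_ite_of_true (fun _ h => h), sum_const, nsmul_eq_mul]
    ring
  rw [h4] at h3
  simp only [sum_const, card_univ, nsmul_eq_mul, ← hH]
  have h5 : H * ((#S : ℝ) ^ 2 / Fintype.card Y) = #S ^ 2 * H / Fintype.card Y := by ring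
  linarith

/-! ### Random parametrised subspaces in sparse sets -/

/-- Splitting off the first of the vectors `T i`. -/
theorem card_exists_translate_succ_le {G : Type*} [AddCommGroup G] [Module (ZMod 2) G] [Fintype G]
    [DecidableEq G] (k : ℕ) (B : (Fin (k + 1) → ZMod 2) → Finset G) :
    Nat.card {T : Fin (k + 1) → G // ∃ y, ∀ z, y + ∑ i, z i • T i ∈ B z} ≤
      ∑ u : G, Nat.card {T : Fin k → G // ∃ y, ∀ z : Fin k → ZMod 2, y + ∑ i, z i • T i ∈
        ({y ∈ B (Fin.cons 0 z) | y + u ∈ B (Fin.cons 1 z)} : Finset G)} := by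
  rw [← Nat.card_sigma]
  refine Nat.card_le_card_of_injective (fun T => ⟨T.1 0, fun i => T.1 i.succ, ?_⟩) ?_
  · obtain ⟨T, y, hy⟩ := T
    refine ⟨y, fun z => mem_filter.2 ⟨?_, ?_⟩⟩
    · have := hy (Fin.cons 0 z)
      rwa [Fin.sum_univ_succ, Fin.cons_zero, zero_smul, zero_add] at this
    · have := hy (Fin.cons 1 z)
      rw [Fin.sum_univ_succ, Fin.cons_zero, one_smul] at this
      have h : y + ∑ i : Fin k, z i • T i.succ + T 0 = y + (T 0 + ∑ i : Fin k, z i • T i.succ) := by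
        abel
      exact h ▸ this
  · rintro ⟨T, hT⟩ ⟨T', hT'⟩ h
    have h0 : T 0 = T' 0 := congrArg Sigma.fst h
    have h1 := congrArg (fun p => p.2.1) h
    exact Subtype.ext (funext fun i => Fin.cases h0 (fun i => congrFun h1 i) i)

theorem sum_card_inter_translate {G : Type*} [AddCommGroup G] [Fintype G] [DecidableEq G]
    (A B : Finset G) : ∑ u : G, (#{y ∈ A | y + u ∈ B} : ℝ) = #A * #B := by
  simp only [card_filter]
  push_cast
  rw [sum_comm]
  have : ∀ y : G, (∑ u : G, if y + u ∈ B then (1 : ℝ) else 0) = #B := by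
    intro y
    exact (Equiv.sum_comp (Equiv.addLeft y) (fun u => if u ∈ B then (1 : ℝ) else 0)).trans (by simp)
  simp [this]

/-- Averaging over the split-off vector replaces paired slices by products of their sizes; this
turns their sum into the square that drives the induction. -/
theorem sum_mul_cons_le_sq {k : ℕ} (b : (Fin (k + 1) → ZMod 2) → ℝ) (hb : ∀ z, 0 ≤ b z) :
    ∑ z : Fin k → ZMod 2, b (Fin.cons 0 z) * b (Fin.cons 1 z) ≤ (∑ z, b z) ^ 2 := by
  have hsplit : ∑ z, b z = ∑ z : Fin k → ZMod 2, b (Fin.cons 0 z) +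
      ∑ z : Fin k → ZMod 2, b (Fin.cons 1 z) := by
    rw [← (Fin.consEquiv fun _ : Fin (k + 1) => ZMod 2).sum_comp, Fintype.sum_prod_type]
    exact Fin.sum_univ_two _
  have h1 : ∑ z : Fin k → ZMod 2, b (Fin.cons 0 z) * b (Fin.cons 1 z) ≤
      (∑ z : Fin k → ZMod 2, b (Fin.cons 0 z)) * ∑ z : Fin k → ZMod 2, b (Fin.cons 1 z) := by
    rw [sum_mul]
    exact sum_le_sum fun z _ => mul_le_mul_of_nonneg_left
      (single_le_sum (f := fun z : Fin k → ZMod 2 => b (Fin.cons 1 z)) (fun _ _ => hb _)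
        (mem_univ z)) (hb _)
  have h2 : 0 ≤ ∑ z : Fin k → ZMod 2, b (Fin.cons 0 z) := sum_nonneg fun _ _ => hb _
  have h3 : 0 ≤ ∑ z : Fin k → ZMod 2, b (Fin.cons 1 z) := sum_nonneg fun _ _ => hb _
  rw [hsplit]
  nlinarith

/-- If the slices `B z` are small, few choices of the vectors `T i` admit a translate of the
parametrised subspace `z ↦ ∑ i, z i • T i` inside them. -/
theorem card_exists_translate_le {G : Type*} [AddCommGroup G] [Module (ZMod 2) G] [Fintype G]
    [DecidableEq G] (k : ℕ) (c : ℝ) (hc0 : 0 ≤ c) (hc : (Fintype.card G : ℝ) ≤ c ^ 2 ^ k)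
    (B : (Fin k → ZMod 2) → Finset G) :
    (Nat.card {T : Fin k → G // ∃ y, ∀ z, y + ∑ i, z i • T i ∈ B z} : ℝ) ≤
      c * ((∑ z, (#(B z) : ℝ)) / Fintype.card G) * (Fintype.card G : ℝ) ^ k := by
  have hG : (0 : ℝ) < Fintype.card G := by exact_mod_cast Fintype.card_pos
  induction k generalizing c with
  | zero =>
    simp only [pow_zero, pow_one, mul_one] at hc ⊢
    rw [Fintype.sum_subsingleton _ (0 : Fin 0 → ZMod 2)]
    rcases (B 0).eq_empty_or_nonempty with h | h
    · have : IsEmpty {T : Fin 0 → G // ∃ y, ∀ z, y + ∑ i, z i • T i ∈ B z} := by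
        refine ⟨fun ⟨T, y, hy⟩ => ?_⟩
        have := hy 0
        rw [h] at this
        exact notMem_empty _ this
      rw [Nat.card_of_isEmpty, Nat.cast_zero]
      positivity
    · have h1 : (1 : ℝ) ≤ #(B 0) := by exact_mod_cast h.card_pos
      have h2 : (Nat.card {T : Fin 0 → G // ∃ y, ∀ z, y + ∑ i, z i • T i ∈ B z} : ℝ) ≤ 1 := by
        have : Nat.card {T : Fin 0 → G // ∃ y, ∀ z, y + ∑ i, z i • T i ∈ B z} ≤ 1 :=
          Finite.card_le_one_iff_subsingleton.2 inferInstance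
        exact_mod_cast this
      refine h2.trans ?_
      rw [← mul_div_assoc, le_div_iff₀ hG, one_mul]
      exact hc.trans (le_mul_of_one_le_right hc0 h1)
  | succ k ih =>
    have hstep : (Nat.card {T : Fin (k + 1) → G // ∃ y, ∀ z, y + ∑ i, z i • T i ∈ B z} : ℝ) ≤ _ :=
      Nat.cast_le.2 (card_exists_translate_succ_le k B)
    have hone : (Nat.card {T : Fin (k + 1) → G // ∃ y, ∀ z, y + ∑ i, z i • T i ∈ B z} : ℝ) ≤
        (Fintype.card G : ℝ) ^ (k + 1) := by
      have : Nat.card {T : Fin (k + 1) → G // ∃ y, ∀ z, y + ∑ i, z i • T i ∈ B z} ≤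
          Nat.card (Fin (k + 1) → G) := Nat.card_le_card_of_injective _ Subtype.val_injective
      rw [Nat.card_fun, Nat.card_eq_fintype_card (α := G), Nat.card_fin] at this
      exact_mod_cast this
    rw [Nat.cast_sum] at hstep
    generalize (Nat.card {T : Fin (k + 1) → G // ∃ y, ∀ z, y + ∑ i, z i • T i ∈ B z} : ℝ) = P
      at hstep hone ⊢
    have hprod := sum_mul_cons_le_sq (fun z => (#(B z) : ℝ)) fun _ => Nat.cast_nonneg _
    have hΦ0 : 0 ≤ ∑ z, (#(B z) : ℝ) := sum_nonneg fun _ _ => Nat.cast_nonneg _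
    have hsq : P ≤ (c * ((∑ z, (#(B z) : ℝ)) / Fintype.card G)) ^ 2 *
        (Fintype.card G : ℝ) ^ (k + 1) := by
      -- The exponent `2 ^ k` halves at each step, so the constant is squared: `c ^ 2 ^ (k + 1) = (c
      -- ^ 2) ^ 2 ^ k`.
      refine (hstep.trans (sum_le_sum fun u _ =>
        ih (c ^ 2) (sq_nonneg c) (by rwa [← pow_mul, ← pow_succ']) _)).trans ?_
      rw [← sum_mul, ← mul_sum, ← sum_div, sum_comm]
      simp_rw [sum_card_inter_translate]
      calc _ ≤ c ^ 2 * ((∑ z, (#(B z) : ℝ)) ^ 2 / Fintype.card G) * (Fintype.card G : ℝ) ^ k := by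
            gcongr
        _ = _ := by field_simp; ring
    generalize (∑ z, (#(B z) : ℝ)) = Φ at hΦ0 hsq ⊢
    have ha : 0 ≤ c * (Φ / Fintype.card G) := by positivity
    generalize c * (Φ / Fintype.card G) = a at ha hsq ⊢
    have hN : (0 : ℝ) ≤ (Fintype.card G : ℝ) ^ (k + 1) := by positivity
    -- `P` is at most both `a ^ 2` and `1` times the number of all `T`, and `min (a ^ 2) 1 ≤ a`.
    -- This restores a bound linear in `c`.
    rcases le_total a 1 with h | h
    · nlinarith [mul_nonneg hN (mul_nonneg ha (sub_nonneg.2 h))]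
    · nlinarith [mul_nonneg hN (sub_nonneg.2 h)]


/-! ### From columns of deviating pieces to the tail bound -/

/-- Shears preserve the uniform measure on pairs, so a full bad column is as likely as a bad sheared
column averaged over all shears; for a fixed pair the latter is controlled by the density of its bad
set. -/
theorem card_exists_deviating_coset_le {V Y : Type*} [AddCommGroup V] [Module (ZMod 2) V]
    [AddCommGroup Y] [Module (ZMod 2) Y] [Fintype Y] [DecidableEq Y] (k : ℕ)
    [Fintype (V →ₗ[ZMod 2] Y)] [Fintype (V →ₗ[ZMod 2] (Fin k → ZMod 2))]
    (S : Finset V) (c η μ : ℝ) (hc0 : 0 ≤ c) (hc : (Fintype.card Y : ℝ) ≤ c ^ 2 ^ k) (hη : 0 ≤ η)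
    (hμ : μ = #S / (Fintype.card Y * 2 ^ k)) :
    (Nat.card {p : (V →ₗ[ZMod 2] Y) × (V →ₗ[ZMod 2] (Fin k → ZMod 2)) //
      ∃ y, ∀ z, η ≤ |(#{x ∈ S | p.1 x = y ∧ p.2 x = z} : ℝ) - μ|} : ℝ) *
        (Fintype.card Y * η ^ 2) ≤ c * #S *
      (Fintype.card (V →ₗ[ZMod 2] Y) * Fintype.card (V →ₗ[ZMod 2] (Fin k → ZMod 2))) := by
  classical
  let H := (V →ₗ[ZMod 2] Y) × (V →ₗ[ZMod 2] (Fin k → ZMod 2))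
  let N : H → Y → (Fin k → ZMod 2) → ℝ := fun p y z => #{x ∈ S | p.1 x = y ∧ p.2 x = z}
  let B : H → (Fin k → ZMod 2) → Finset Y := fun p z => {y | η ≤ |N p y z - μ|}
  have hY : (0 : ℝ) < Fintype.card Y := by exact_mod_cast Fintype.card_pos
  -- the second moment bound
  have hsum : ∑ p : H, (∑ z, (#(B p z) : ℝ)) * η ^ 2 ≤ Fintype.card H * #S := by
    -- A pair of maps is one map into the product, so the second moment bound applies to the pieces.
    let e : H ≃ (V →ₗ[ZMod 2] Y × (Fin k → ZMod 2)) :=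
      (LinearMap.prodEquiv (ZMod 2) (M := V) (M₂ := Y) (M₃ := Fin k → ZMod 2)).toEquiv
    let _ : Fintype (V →ₗ[ZMod 2] Y × (Fin k → ZMod 2)) := Fintype.ofEquiv _ e
    have h := sum_linearMap_sum_sq_deviation_le (F := ZMod 2) (Y := Y × (Fin k → ZMod 2)) S
    rw [← Fintype.card_congr e, ← e.sum_comp] at h
    refine le_trans (sum_le_sum fun p _ => ?_) h
    rw [Fintype.sum_prod_type_right, sum_mul]
    refine sum_le_sum fun z _ => ?_
    have h1 : ∀ y, (#{x ∈ S | e p x = (y, z)} : ℝ) - #S / Fintype.card (Y × (Fin k → ZMod 2)) =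
        N p y z - μ := by
      intro y
      simp [N, e, hμ, Prod.ext_iff]
      rfl
    simp_rw [h1]
    rw [card_filter, Nat.cast_sum, sum_mul]
    refine sum_le_sum fun y _ => ?_
    split_ifs with h2
    · rw [Nat.cast_one, one_mul, ← sq_abs (N p y z - μ)]
      gcongr
    · rw [Nat.cast_zero, zero_mul]
      positivity
  -- averaging over shears
  let sh : (Fin k → Y) → H ≃ H := fun T =>
    { toFun := fun p => (p.1 - (Fintype.linearCombination (ZMod 2) T) ∘ₗ p.2, p.2)
      invFun := fun p => (p.1 + (Fintype.linearCombination (ZMod 2) T) ∘ₗ p.2, p.2)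
      left_inv := fun p => by simp
      right_inv := fun p => by simp }
  have hsh : ∀ T p y z, N (sh T p) y z = N p (y + ∑ i, z i • T i) z := by
    intro T p y z
    simp only [N, sh, Equiv.coe_fn_mk]
    congr 2
    ext x
    simp only [mem_filter]
    refine and_congr_right fun _ => and_congr_left fun h => ?_
    rw [LinearMap.sub_apply, LinearMap.comp_apply, h, Fintype.linearCombination_apply,
      sub_eq_iff_eq_add]
  have hcount : (Fintype.card Y : ℝ) ^ k * (#{p : H | ∃ y, ∀ z, η ≤ |N p y z - μ|} : ℝ) =
      ∑ p : H, (#{T : Fin k → Y | ∃ y, ∀ z, y + ∑ i, z i • T i ∈ B p z} : ℝ) := by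
    have h1 : ∀ T : Fin k → Y, (#{p : H | ∃ y, ∀ z, η ≤ |N p y z - μ|} : ℝ) =
        ∑ p : H, if ∃ y, ∀ z, y + ∑ i, z i • T i ∈ B p z then (1 : ℝ) else 0 := by
      intro T
      rw [card_filter, Nat.cast_sum, ← (sh T).sum_comp]
      refine sum_congr rfl fun p _ => ?_
      simp [hsh, B]
    have h2 : ∑ T : Fin k → Y, (#{p : H | ∃ y, ∀ z, η ≤ |N p y z - μ|} : ℝ) =
        (Fintype.card Y : ℝ) ^ k * (#{p : H | ∃ y, ∀ z, η ≤ |N p y z - μ|} : ℝ) := by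
      simp
    rw [← h2, sum_congr rfl fun T _ => h1 T, sum_comm]
    simp
  have hbound : (Fintype.card Y : ℝ) ^ k * (#{p : H | ∃ y, ∀ z, η ≤ |N p y z - μ|} : ℝ) ≤
      ∑ p : H, c * ((∑ z, (#(B p z) : ℝ)) / Fintype.card Y) * (Fintype.card Y : ℝ) ^ k := by
    rw [hcount]
    refine sum_le_sum fun p _ => ?_
    have := card_exists_translate_le k c hc0 hc (B p)
    rwa [Nat.card_eq_fintype_card, Fintype.card_subtype] at this
  have hE : (Nat.card {p : H // ∃ y, ∀ z, η ≤ |N p y z - μ|} : ℝ) =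
      #{p : H | ∃ y, ∀ z, η ≤ |N p y z - μ|} := by
    rw [Nat.card_eq_fintype_card, Fintype.card_subtype]
  change (Nat.card {p : H // ∃ y, ∀ z, η ≤ |N p y z - μ|} : ℝ) * _ ≤ _
  rw [hE]
  rw [← sum_mul, mul_comm, mul_le_mul_iff_left₀ (by positivity), ← mul_sum, ← sum_div] at hbound
  rw [← sum_mul, Fintype.card_prod, Nat.cast_mul] at hsum
  generalize (∑ p : H, ∑ z, (#(B p z) : ℝ)) = Φ at hbound hsum
  calc _ ≤ c * (Φ / Fintype.card Y) * (Fintype.card Y * η ^ 2) := by gcongr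
    _ = c * (Φ * η ^ 2) := by field_simp
    _ ≤ c * (Fintype.card (V →ₗ[ZMod 2] Y) * Fintype.card (V →ₗ[ZMod 2] (Fin k → ZMod 2)) * #S) := by
        gcongr
    _ = _ := by ring

/-- With probability at least one half, all buckets of a random linear map deviate little. -/
theorem card_le_two_mul_card_small_deviation {F V Z : Type*} [Field F] [AddCommGroup V]
    [Module F V] [AddCommGroup Z] [Module F Z] [Fintype Z] [DecidableEq Z] [Fintype (V →ₗ[F] Z)]
    (S : Finset V) (d : ℝ) (hd : 0 < d) (hS : 2 * #S ≤ d ^ 2) :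
    (Fintype.card (V →ₗ[F] Z) : ℝ) ≤ 2 * (Nat.card {L : V →ₗ[F] Z //
      ∀ z, |(#{x ∈ S | L x = z} : ℝ) - #S / Fintype.card Z| < d} : ℝ) := by
  classical
  rw [Nat.card_eq_fintype_card, Fintype.card_subtype]
  set good : Finset (V →ₗ[F] Z) :=
    {L | ∀ z, |(#{x ∈ S | L x = z} : ℝ) - #S / Fintype.card Z| < d} with hgood
  have h := sum_linearMap_sum_sq_deviation_le (F := F) (Y := Z) S
  have h1 : (#goodᶜ : ℝ) * d ^ 2 ≤ Fintype.card (V →ₗ[F] Z) * #S := by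
    refine le_trans ?_ h
    rw [← nsmul_eq_mul, ← sum_const]
    refine le_trans (sum_le_sum fun L hL => ?_) (sum_le_univ_sum_of_nonneg fun L => ?_)
    · simp only [hgood, mem_compl, mem_filter, mem_univ, true_and, not_forall, not_lt] at hL
      obtain ⟨z, hz⟩ := hL
      refine le_trans ?_ (single_le_sum (fun z _ => sq_nonneg _) (mem_univ z))
      rw [← sq_abs (_ - _)]
      gcongr
    · exact sum_nonneg fun z _ => sq_nonneg _
  have h2 : (#good : ℝ) + #goodᶜ = Fintype.card (V →ₗ[F] Z) := by
    exact_mod_cast card_add_card_compl good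
  have h3 : (#goodᶜ : ℝ) * d ^ 2 ≤ Fintype.card (V →ₗ[F] Z) / 2 * d ^ 2 := by
    have : (0 : ℝ) ≤ Fintype.card (V →ₗ[F] Z) := by positivity
    nlinarith
  have h4 := le_of_mul_le_mul_right h3 (by positivity)
  linarith

/-- Supplies the Chebyshev condition for splitting a bad bucket of size `K'` into `Q` pieces. `K'`
has no upper bound, but the allowed deviation grows with it. -/
theorem two_mul_le_sq_deviation {K K' Q τ : ℝ} (hτ : 0 < τ) (hQ : 0 < Q) (hK : 0 < K)
    (hKQ : 8 * Q ^ 2 * (1 + τ) ≤ τ ^ 2 * K) (hbad : τ * K < |K' - K|) :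
    0 < |K' / Q - K / Q| - τ * (K / Q) / 2 ∧
      2 * K' ≤ (|K' / Q - K / Q| - τ * (K / Q) / 2) ^ 2 := by
  have h1 : |K' / Q - K / Q| = |K' - K| / Q := by
    rw [← sub_div, abs_div, abs_of_pos hQ]
  have h2 : |K' - K| / Q - τ * (K / Q) / 2 = (|K' - K| - τ * K / 2) / Q := by
    field_simp
  have hτK : 0 < τ * K := mul_pos hτ hK
  rw [h1, h2]
  refine ⟨div_pos (by linarith) hQ, ?_⟩
  rw [div_pow, le_div_iff₀ (by positivity)]
  -- In terms of the excess `s`, the claim follows from `2 Q² (K (1 + τ) + s) ≤ (s + τ K / 2)²`: the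
  -- constant term is `hKQ`, the linear term is `h6`.
  set s := |K' - K| - τ * K with hs
  have hs0 : 0 < s := by linarith
  have h3 : K' ≤ K * (1 + τ) + s := by
    have := le_abs_self (K' - K)
    linarith
  have h4 : |K' - K| - τ * K / 2 = s + τ * K / 2 := by linarith
  rw [h4]
  have h5 : 8 * Q ^ 2 ≤ τ ^ 2 * K := by nlinarith [mul_pos (sq_pos_of_pos hQ) hτ]
  have h6 : 8 * Q ^ 2 * s ≤ 4 * τ * K * s := by
    have : 8 * Q ^ 2 ≤ 4 * τ * K := by
      have h7 : 8 * Q ^ 2 * τ ≤ τ ^ 2 * K := by nlinarith [sq_pos_of_pos hQ]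
      have h8 : 8 * Q ^ 2 ≤ τ * K := by nlinarith
      linarith
    exact mul_le_mul_of_nonneg_right this hs0.le
  nlinarith [mul_le_mul_of_nonneg_right hKQ hK.le, mul_le_mul_of_nonneg_right h3 (sq_nonneg Q),
    sq_nonneg s]

/-- Few linear maps have a bucket whose size deviates from the mean by a factor `τ`. -/
theorem card_deviating_linearMap_le {V Y : Type*} [AddCommGroup V] [Module (ZMod 2) V]
    [AddCommGroup Y] [Module (ZMod 2) Y] [Fintype Y] [DecidableEq Y] (k : ℕ)
    [Fintype (V →ₗ[ZMod 2] Y)] [Fintype (V →ₗ[ZMod 2] (Fin k → ZMod 2))]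
    (S : Finset V) (τ K : ℝ) (hτ : 0 < τ) (hK0 : 0 < K) (hK : K = #S / Fintype.card Y)
    (hY : (Fintype.card Y : ℝ) ≤ 2 ^ 2 ^ k)
    (hKQ : 8 * ((2 : ℝ) ^ k) ^ 2 * (1 + τ) ≤ τ ^ 2 * K) :
    (Nat.card {L : V →ₗ[ZMod 2] Y // ∃ y, τ * K < |(#{x ∈ S | L x = y} : ℝ) - K|} : ℝ) *
      (τ ^ 2 * K) ≤ 16 * ((2 : ℝ) ^ k) ^ 2 * Fintype.card (V →ₗ[ZMod 2] Y) := by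
  classical
  have hY0 : (0 : ℝ) < Fintype.card Y := by exact_mod_cast Fintype.card_pos
  set Q : ℝ := (2 : ℝ) ^ k with hQdef
  have hQ : 0 < Q := by positivity
  have hμ : K / Q = #S / (Fintype.card Y * Q) := by rw [hK, div_div]
  have hη : 0 ≤ τ * (K / Q) / 2 := by positivity
  have hE := card_exists_deviating_coset_le (V := V) (Y := Y) k S 2 _ _ zero_le_two hY hη hμ
  set HY : ℝ := ((Fintype.card (V →ₗ[ZMod 2] Y) : ℕ) : ℝ)
  set HZ : ℝ := ((Fintype.card (V →ₗ[ZMod 2] (Fin k → ZMod 2)) : ℕ) : ℝ) with hHZ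
  have hHZ0 : 0 < HZ := by
    rw [hHZ]
    exact_mod_cast Fintype.card_pos
  have hhalf : (Nat.card {L : V →ₗ[ZMod 2] Y // ∃ y, τ * K < |(#{x ∈ S | L x = y} : ℝ) - K|} : ℝ) *
      HZ ≤ 2 * (Nat.card {p : (V →ₗ[ZMod 2] Y) × (V →ₗ[ZMod 2] (Fin k → ZMod 2)) //
      ∃ y, ∀ z, τ * (K / Q) / 2 ≤ |(#{x ∈ S | p.1 x = y ∧ p.2 x = z} : ℝ) - K / Q|} : ℝ) := by
    have h1 : ∀ L : {L : V →ₗ[ZMod 2] Y // ∃ y, τ * K < |(#{x ∈ S | L x = y} : ℝ) - K|},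
        HZ ≤ 2 * (Nat.card {L' : V →ₗ[ZMod 2] (Fin k → ZMod 2) // ∃ y, ∀ z,
          τ * (K / Q) / 2 ≤ |(#{x ∈ S | L.1 x = y ∧ L' x = z} : ℝ) - K / Q|} : ℝ) := by
      rintro ⟨L, y, hy⟩
      obtain ⟨hd, hd2⟩ := two_mul_le_sq_deviation hτ hQ hK0 hKQ hy
      -- The half-probability bound is applied to the bad bucket in place of `S`; the triangle
      -- inequality then leaves each piece at least `τ * (K / Q) / 2` away from `K / Q`.
      refine (card_le_two_mul_card_small_deviation (F := ZMod 2) (Z := Fin k → ZMod 2)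
        {x ∈ S | L x = y} _ hd hd2).trans ?_
      gcongr
      refine Nat.card_le_card_of_injective (Subtype.map id fun L' hL' => ⟨y, fun z => ?_⟩)
        (Subtype.map_injective _ Function.injective_id)
      have h2 := hL' z
      rw [filter_filter] at h2
      have hcard : (Fintype.card (Fin k → ZMod 2) : ℝ) = Q := by simp [hQdef]
      rw [hcard] at h2
      simp only [id]
      have h3 := abs_sub_abs_le_abs_sub
        ((#{x ∈ S | L x = y} : ℝ) / Q - K / Q) ((#{x ∈ S | L x = y ∧ L' x = z} : ℝ) - K / Q)
      rw [sub_sub_sub_cancel_right] at h3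
      have h4 := abs_sub_comm ((#{x ∈ S | L x = y} : ℝ) / Q) (#{x ∈ S | L x = y ∧ L' x = z} : ℝ)
      linarith
    have h2 : Nat.card (Σ L : {L : V →ₗ[ZMod 2] Y //
          ∃ y, τ * K < |(#{x ∈ S | L x = y} : ℝ) - K|},
        {L' : V →ₗ[ZMod 2] (Fin k → ZMod 2) // ∃ y, ∀ z,
          τ * (K / Q) / 2 ≤ |(#{x ∈ S | L.1 x = y ∧ L' x = z} : ℝ) - K / Q|}) ≤
        Nat.card {p : (V →ₗ[ZMod 2] Y) × (V →ₗ[ZMod 2] (Fin k → ZMod 2)) //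
      ∃ y, ∀ z, τ * (K / Q) / 2 ≤ |(#{x ∈ S | p.1 x = y ∧ p.2 x = z} : ℝ) - K / Q|} := by
      refine Nat.card_le_card_of_injective (fun a => ⟨(a.1.1, a.2.1), a.2.2⟩) ?_
      rintro ⟨⟨L, hL⟩, ⟨L', hL'⟩⟩ ⟨⟨M, hM⟩, ⟨M', hM'⟩⟩ h
      simp only [Subtype.mk.injEq, Prod.mk.injEq] at h
      obtain ⟨rfl, rfl⟩ := h
      rfl
    rw [Nat.card_sigma] at h2
    have h3 := sum_le_sum fun L (_ : L ∈ (univ : Finset {L : V →ₗ[ZMod 2] Y //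
      ∃ y, τ * K < |(#{x ∈ S | L x = y} : ℝ) - K|})) => h1 L
    rw [sum_const, nsmul_eq_mul, card_univ, ← Nat.card_eq_fintype_card, ← mul_sum] at h3
    refine h3.trans ?_
    gcongr
    exact_mod_cast h2
  generalize (Nat.card {p : (V →ₗ[ZMod 2] Y) × (V →ₗ[ZMod 2] (Fin k → ZMod 2)) //
      ∃ y, ∀ z, τ * (K / Q) / 2 ≤ |(#{x ∈ S | p.1 x = y ∧ p.2 x = z} : ℝ) - K / Q|} : ℝ) = E
    at hE hhalf
  generalize (Nat.card {L : V →ₗ[ZMod 2] Y //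
    ∃ y, τ * K < |(#{x ∈ S | L x = y} : ℝ) - K|} : ℝ) = b at hhalf ⊢
  have hS : (#S : ℝ) = K * Fintype.card Y := by rw [hK]; field_simp
  rw [hS] at hE
  have h1 : E * (τ ^ 2 * K) ≤ 8 * Q ^ 2 * (HY * HZ) := by
    have h2 : (E * (τ ^ 2 * K)) * (Fintype.card Y * K / (4 * Q ^ 2)) ≤
        (8 * Q ^ 2 * (HY * HZ)) * (Fintype.card Y * K / (4 * Q ^ 2)) := by
      calc _ = E * (Fintype.card Y * (τ * (K / Q) / 2) ^ 2) := by field_simp; ring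
        _ ≤ _ := hE
        _ = _ := by field_simp; ring
    exact le_of_mul_le_mul_right h2 (by positivity)
  have h2 : (b * (τ ^ 2 * K)) * HZ ≤ (16 * Q ^ 2 * HY) * HZ := by
    have : 0 < τ ^ 2 * K := by positivity
    nlinarith
  exact le_of_mul_le_mul_right h2 hHZ0

/-! ### Surjective maps and the distribution of the output -/

/-- At least half of all linear maps are surjective once the domain is larger than the codomain. -/
theorem card_le_two_mul_card_surjective {n t : ℕ} (h : t + 1 ≤ n) :
    Nat.card ((Fin n → ZMod 2) →ₗ[ZMod 2] (Fin t → ZMod 2)) ≤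
      2 * Nat.card {L : (Fin n → ZMod 2) →ₗ[ZMod 2] (Fin t → ZMod 2) // Function.Surjective L} := by
  classical
  let X := (Fin n → ZMod 2) →ₗ[ZMod 2] (Fin t → ZMod 2)
  have hdual : ∀ m : ℕ, Nat.card (Module.Dual (ZMod 2) (Fin m → ZMod 2)) = 2 ^ m := by
    intro m
    rw [Module.natCard_eq_pow_finrank (K := ZMod 2), Subspace.dual_finrank_eq]
    simp
  have hfin : Finite X := Module.finite_of_finite (ZMod 2)
  have hfinD : Finite (Module.Dual (ZMod 2) (Fin t → ZMod 2)) := Module.finite_of_finite (ZMod 2)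
  let _ : Fintype X := Fintype.ofFinite X
  let _ : Fintype (Module.Dual (ZMod 2) (Fin t → ZMod 2)) := Fintype.ofFinite _
  have hsub : (univ.filter fun L : X => ¬ Function.Surjective L) ⊆
      (univ.filter fun φ : Module.Dual (ZMod 2) (Fin t → ZMod 2) => φ ≠ 0).biUnion
        fun φ => univ.filter fun L : X => φ ∘ₗ L = 0 := by
    intro L hL
    simp only [mem_filter, mem_univ, true_and, mem_biUnion] at hL ⊢
    rw [← LinearMap.range_eq_top] at hL
    obtain ⟨φ, hφ, hle⟩ := Submodule.exists_le_ker_of_lt_top _ (lt_top_iff_ne_top.2 hL)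
    exact ⟨φ, hφ, LinearMap.range_le_ker_iff.1 hle⟩
  have hle : #(univ.filter fun L : X => ¬ Function.Surjective L) * 2 ^ n ≤ 2 ^ t * Nat.card X := by
    calc _ ≤ (∑ φ : Module.Dual (ZMod 2) (Fin t → ZMod 2) with φ ≠ 0,
          #(univ.filter fun L : X => φ ∘ₗ L = 0)) * 2 ^ n :=
          Nat.mul_le_mul_right _ ((card_le_card hsub).trans card_biUnion_le)
      _ = ∑ φ : Module.Dual (ZMod 2) (Fin t → ZMod 2) with φ ≠ 0, Nat.card X := by
          rw [sum_mul]
          refine sum_congr rfl fun φ hφ => ?_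
          rw [← hdual n, ← Fintype.card_subtype, ← Nat.card_eq_fintype_card]
          exact card_linearMap_dual_comp_eq_zero (mem_filter.1 hφ).2
      _ ≤ ∑ φ : Module.Dual (ZMod 2) (Fin t → ZMod 2), Nat.card X :=
          sum_le_sum_of_subset (filter_subset _ _)
      _ = 2 ^ t * Nat.card X := by
          rw [sum_const, card_univ, ← Nat.card_eq_fintype_card, hdual, smul_eq_mul]
  have hpow : 2 ^ t * 2 ≤ 2 ^ n := by
    rw [← pow_succ]
    exact Nat.pow_le_pow_right two_pos h
  have hsplit : #(univ.filter fun L : X => Function.Surjective L) +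
      #(univ.filter fun L : X => ¬ Function.Surjective L) = Nat.card X := by
    rw [card_filter_add_card_filter_not, card_univ, Nat.card_eq_fintype_card]
  have h2 : #(univ.filter fun L : X => ¬ Function.Surjective L) * 2 ≤ Nat.card X := by
    have : (#(univ.filter fun L : X => ¬ Function.Surjective L) * 2) * 2 ^ t ≤
        Nat.card X * 2 ^ t := by
      calc _ = #(univ.filter fun L : X => ¬ Function.Surjective L) * (2 ^ t * 2) := by ring
        _ ≤ #(univ.filter fun L : X => ¬ Function.Surjective L) * 2 ^ n :=
          Nat.mul_le_mul_left _ hpow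
        _ ≤ _ := hle
        _ = _ := mul_comm _ _
    exact Nat.le_of_mul_le_mul_right this (by positivity)
  rw [Nat.card_eq_fintype_card (α := {L : X // Function.Surjective L}), Fintype.card_subtype]
  change Nat.card X ≤ _
  omega
theorem imageOfUniform_apply_toReal {X Y : Type*} [DecidableEq Y] (S : Finset X) (hS : S.Nonempty)
    (L : X → Y) (y : Y) : (imageOfUniform S hS L y).toReal = (#{x ∈ S | L x = y} : ℝ) / #S := by
  classical
  rw [imageOfUniform, PMF.map_apply, tsum_eq_sum (s := S)]
  · have h : ∀ x ∈ S, (@ite _ (y = L x) (Classical.propDecidable _)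
        (PMF.uniformOfFinset S hS x) 0) = if L x = y then (#S : ENNReal)⁻¹ else 0 := by
      intro x hx
      rw [PMF.uniformOfFinset_apply_of_mem hS hx]
      by_cases hy : L x = y
      · simp [hy]
      · simp [hy, Ne.symm hy]
    rw [sum_congr rfl h, ← sum_filter, sum_const, nsmul_eq_mul]
    simp [div_eq_mul_inv]
  · intro x hx
    simp [PMF.uniformOfFinset_apply_of_notMem hS hx]

/-- Restricting to surjective maps at most doubles the bad fraction, whence the factor `2` in `hP`.
-/
theorem fractionOfSurjective_ge {n t : ℕ}
    (P : ((Fin n → ZMod 2) →ₗ[ZMod 2] (Fin t → ZMod 2)) → Prop) (δ : ℝ) (h : t + 1 ≤ n)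
    (hP : 2 * (Nat.card {L // ¬ P L} : ℝ) ≤
      δ * Nat.card ((Fin n → ZMod 2) →ₗ[ZMod 2] (Fin t → ZMod 2))) (hδ : 0 ≤ δ) :
    1 - δ ≤ fractionOfSurjective n t P := by
  have hfin : Finite ((Fin n → ZMod 2) →ₗ[ZMod 2] (Fin t → ZMod 2)) :=
    Module.finite_of_finite (ZMod 2)
  have hhalf : (Nat.card ((Fin n → ZMod 2) →ₗ[ZMod 2] (Fin t → ZMod 2)) : ℝ) ≤
      2 * (surjectiveLinearMaps n t).ncard := by
    exact_mod_cast card_le_two_mul_card_surjective h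
  have hpos : (0 : ℝ) < Nat.card ((Fin n → ZMod 2) →ₗ[ZMod 2] (Fin t → ZMod 2)) := by
    exact_mod_cast Nat.card_pos
  have hsplit : (surjectiveLinearMaps n t).ncard ≤
      {L ∈ surjectiveLinearMaps n t | P L}.ncard + {L | ¬ P L}.ncard := by
    refine (Set.ncard_le_ncard (fun L hL => ?_) (Set.toFinite _)).trans (Set.ncard_union_le _ _)
    by_cases hPL : P L
    · exact Or.inl ⟨hL, hPL⟩
    · exact Or.inr hPL
  have hsplit' : ((surjectiveLinearMaps n t).ncard : ℝ) ≤
      {L ∈ surjectiveLinearMaps n t | P L}.ncard + Nat.card {L // ¬ P L} := by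
    exact_mod_cast hsplit
  rw [fractionOfSurjective, le_div_iff₀ (by linarith)]
  nlinarith [mul_le_mul_of_nonneg_left hhalf hδ]

theorem isLinftyCloseToUniform_iff {n t : ℕ} (S : Finset (Fin n → ZMod 2)) (hS : S.Nonempty)
    (τ : ℝ) (L : (Fin n → ZMod 2) → (Fin t → ZMod 2)) :
    IsLinftyCloseToUniform (imageOfUniform S hS L) (τ * ((2 : ℝ) ^ t)⁻¹) ↔
      ∀ y, |(#{x ∈ S | L x = y} : ℝ) - #S / 2 ^ t| ≤ τ * (#S / 2 ^ t) := by
  have hS0 : (0 : ℝ) < #S := by exact_mod_cast hS.card_pos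
  refine forall_congr' fun y => ?_
  rw [imageOfUniform_apply_toReal]
  have hcard : (Fintype.card (Fin t → ZMod 2) : ℝ) = 2 ^ t := by simp
  have h1 : (#{x ∈ S | L x = y} : ℝ) / #S - 1 / 2 ^ t =
      ((#{x ∈ S | L x = y} : ℝ) - #S / 2 ^ t) / #S := by
    field_simp
  rw [hcard, h1, abs_div, abs_of_pos hS0, div_le_iff₀ hS0]
  have h2 : τ * ((2 : ℝ) ^ t)⁻¹ * #S = τ * (#S / 2 ^ t) := by ring
  rw [h2]

/-! ### Choice of parameters and conclusion -/

/-- A choice of the output length with the required entropy loss. -/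
theorem exists_output_length {s M : ℝ} (hM : 0 < M) (hs : 2 ^ 20 * M ^ 4 < s) :
    ∃ t : ℕ, (t : ℝ) ≥ Real.logb 2 s - 4 * Real.logb 2 M - 20 ∧ 2 ^ t * (2 ^ 19 * M ^ 4) ≤ s := by
  have hs0 : 0 < s := lt_trans (by positivity) hs
  have hlog : Real.logb 2 s - 4 * Real.logb 2 M - 20 = Real.logb 2 (s / (2 ^ 20 * M ^ 4)) := by
    rw [Real.logb_div hs0.ne' (by positivity), Real.logb_mul (by positivity) (by positivity),
      Real.logb_pow, Real.logb_pow, Real.logb_self_eq_one one_lt_two]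
    push_cast
    ring
  have hr : 1 < s / (2 ^ 20 * M ^ 4) := by rwa [one_lt_div (by positivity)]
  -- Rounding up costs at most a factor `2`, which turns `2 ^ 20` into `2 ^ 19`.
  refine ⟨⌈Real.logb 2 (s / (2 ^ 20 * M ^ 4))⌉₊, hlog ▸ Nat.le_ceil _, ?_⟩
  have h1 := (Nat.ceil_lt_add_one (Real.logb_pos one_lt_two hr).le).le
  rw [← Real.rpow_natCast]
  have h2 := Real.rpow_le_rpow_of_exponent_le one_le_two h1
  rw [Real.rpow_add two_pos, Real.rpow_one,
    Real.rpow_logb two_pos (by norm_num) (by positivity)] at h2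
  calc _ ≤ s / (2 ^ 20 * M ^ 4) * 2 * (2 ^ 19 * M ^ 4) := by gcongr
    _ = s := by field_simp

theorem mainTheorem3 (n : ℕ) (τ δ : ℝ) (hτ : 0 < τ) (hδ0 : 0 < δ) (hδ1 : δ < 1)
    (S : Finset (Fin n → ZMod 2)) (hS : S.Nonempty)
    (hcard : (S.card : ℝ) >
      2 ^ 20 * max ((n : ℝ) ^ 4 * (1 + τ) ^ 4 / (τ * δ) ^ 8) ((n : ℝ) ^ 4))
    (hn : (n : ℝ) ≥
      5 * ((⌈Real.logb 2 (max ((n : ℝ) * (1 + τ) / (τ * δ) ^ 2) (n : ℝ))⌉ : ℤ) : ℝ) + 25) :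
    ∃ t : ℕ, t ≤ n ∧
      (t : ℝ) ≥ Real.logb 2 (S.card : ℝ)
        - 4 * Real.logb 2 (max ((n : ℝ) * (1 + τ) / (τ * δ) ^ 2) (n : ℝ)) - 20 ∧
      fractionOfSurjective n t
        (fun L => IsLinftyCloseToUniform (imageOfUniform S hS L) (τ * ((2 : ℝ) ^ t)⁻¹))
        ≥ 1 - δ := by
  -- For `n = 0` the maximum is `0`, its logarithm takes the default value `0`, and `hn` reads `0 ≥
  -- 25`.
  have hn1 : (1 : ℝ) ≤ n := by
    rcases Nat.eq_zero_or_pos n with rfl | h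
    · norm_num at hn
    · exact_mod_cast h
  set M := max ((n : ℝ) * (1 + τ) / (τ * δ) ^ 2) (n : ℝ) with hMdef
  have hMn : (n : ℝ) ≤ M := le_max_right _ _
  have hMA : (n : ℝ) * (1 + τ) / (τ * δ) ^ 2 ≤ M := le_max_left _ _
  have hM1 : 1 ≤ M := hn1.trans hMn
  have hM0 : 0 < M := by linarith
  have hs : 2 ^ 20 * M ^ 4 < (#S : ℝ) := by
    refine lt_of_le_of_lt ?_ hcard
    gcongr
    rcases max_choice ((n : ℝ) * (1 + τ) / (τ * δ) ^ 2) (n : ℝ) with h | h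
    · rw [hMdef, h]
      exact le_max_of_le_left (le_of_eq (by ring))
    · rw [hMdef, h]
      exact le_max_right _ _
  obtain ⟨t, ht, htS⟩ := exists_output_length hM0 hs
  have hM4 : 1 ≤ M ^ 4 := one_le_pow₀ hM1
  have htn : t + 1 ≤ n := by
    have h1 : (#S : ℝ) ≤ 2 ^ n := by
      have := card_le_univ S
      rw [Fintype.card_fun, ZMod.card, Fintype.card_fin] at this
      exact_mod_cast this
    have h2 : (2 : ℝ) ^ (t + 1) ≤ 2 ^ n := by
      rw [pow_succ]
      refine (mul_le_mul_of_nonneg_left ?_ (by positivity)).trans (htS.trans h1)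
      linarith
    exact (pow_le_pow_iff_right₀ one_lt_two).1 h2
  refine ⟨t, by omega, ht, fractionOfSurjective_ge _ δ htn ?_ hδ0.le⟩
  -- The lower bound gives `2 ^ t ≤ 2 ^ 2 ^ k`; the upper bound limits the loss `Q²` to `4 n²`.
  obtain ⟨k, hk, hk'⟩ : ∃ k : ℕ, n ≤ 2 ^ k ∧ 2 ^ k ≤ 2 * n := by
    have hn0 : n ≠ 0 := by omega
    refine ⟨Nat.log 2 n + 1, (Nat.lt_pow_succ_log_self one_lt_two n).le, ?_⟩
    rw [pow_succ, mul_comm]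
    exact Nat.mul_le_mul_left _ (Nat.pow_log_le_self 2 hn0)
  have hQ : (2 : ℝ) ^ k ≤ 2 * n := by exact_mod_cast hk'
  have hQ2 : ((2 : ℝ) ^ k) ^ 2 ≤ 4 * (n : ℝ) ^ 2 := by
    calc ((2 : ℝ) ^ k) ^ 2 ≤ (2 * (n : ℝ)) ^ 2 := by gcongr
      _ = 4 * (n : ℝ) ^ 2 := by ring
  set K : ℝ := #S / 2 ^ t with hK
  have hKM : 2 ^ 19 * M ^ 4 ≤ K := by
    rw [hK, le_div_iff₀ (by positivity)]
    linarith
  have hK0 : 0 < K := lt_of_lt_of_le (by positivity) hKM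
  -- the main numerical estimate
  have hnum : (n : ℝ) ^ 2 * (1 + τ) ≤ δ ^ 2 * (τ ^ 2 * M ^ 4) := by
    have h1 : (n : ℝ) * (1 + τ) ≤ M * (τ * δ) ^ 2 := by
      rwa [div_le_iff₀ (by positivity)] at hMA
    have h2 : M ^ 2 ≤ M ^ 4 := pow_le_pow_right₀ hM1 (by norm_num)
    calc (n : ℝ) ^ 2 * (1 + τ) = n * (n * (1 + τ)) := by ring
      _ ≤ M * (M * (τ * δ) ^ 2) := by gcongr
      _ = δ ^ 2 * (τ ^ 2 * M ^ 2) := by ring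
      _ ≤ _ := by gcongr
  have hτK : 2 ^ 19 * (τ ^ 2 * M ^ 4) ≤ τ ^ 2 * K := by
    calc _ = τ ^ 2 * (2 ^ 19 * M ^ 4) := by ring
      _ ≤ _ := by gcongr
  have hA : 0 ≤ τ ^ 2 * M ^ 4 := by positivity
  have hδ2 : δ ^ 2 * (τ ^ 2 * M ^ 4) ≤ δ * (τ ^ 2 * M ^ 4) := by
    gcongr
    nlinarith
  have hδ3 : δ * (τ ^ 2 * M ^ 4) ≤ τ ^ 2 * M ^ 4 := mul_le_of_le_one_left hA hδ1.le
  have hcardY : (Fintype.card (Fin t → ZMod 2) : ℝ) = 2 ^ t := by simp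
  have hfin : ∀ m, Finite ((Fin n → ZMod 2) →ₗ[ZMod 2] (Fin m → ZMod 2)) := fun m =>
    Module.finite_of_finite (ZMod 2)
  let _ : ∀ m, Fintype ((Fin n → ZMod 2) →ₗ[ZMod 2] (Fin m → ZMod 2)) := fun m =>
    Fintype.ofFinite _
  have hbad := card_deviating_linearMap_le (Y := Fin t → ZMod 2) k S τ K hτ hK0
    (by rw [hcardY]) (by
      rw [hcardY]
      exact pow_le_pow_right₀ one_le_two (by omega)) (by
      calc 8 * ((2 : ℝ) ^ k) ^ 2 * (1 + τ) ≤ 8 * (4 * (n : ℝ) ^ 2) * (1 + τ) := by gcongr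
        _ ≤ τ ^ 2 * K := by linarith)
  rw [← Nat.card_eq_fintype_card] at hbad
  simp_rw [isLinftyCloseToUniform_iff, not_forall, not_le]
  generalize (Nat.card {L : (Fin n → ZMod 2) →ₗ[ZMod 2] (Fin t → ZMod 2) //
    ∃ y, τ * K < |(#{x ∈ S | L x = y} : ℝ) - K|} : ℝ) = b at hbad ⊢
  have hH : (0 : ℝ) ≤ Nat.card ((Fin n → ZMod 2) →ₗ[ZMod 2] (Fin t → ZMod 2)) := Nat.cast_nonneg _
  generalize (Nat.card ((Fin n → ZMod 2) →ₗ[ZMod 2] (Fin t → ZMod 2)) : ℝ) = H at hbad hH ⊢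
  have hfinal : 2 * (16 * ((2 : ℝ) ^ k) ^ 2) ≤ δ * (τ ^ 2 * K) := by
    have h1 : δ * (2 ^ 19 * (τ ^ 2 * M ^ 4)) ≤ δ * (τ ^ 2 * K) := by gcongr
    have h2 : (n : ℝ) ^ 2 ≤ n ^ 2 * (1 + τ) := le_mul_of_one_le_right (by positivity) (by linarith)
    nlinarith
  have h1 : (2 * b) * (τ ^ 2 * K) ≤ (δ * H) * (τ ^ 2 * K) := by
    calc _ = 2 * (b * (τ ^ 2 * K)) := by ring
      _ ≤ 2 * (16 * ((2 : ℝ) ^ k) ^ 2 * H) := by gcongr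
      _ = 2 * (16 * ((2 : ℝ) ^ k) ^ 2) * H := by ring
      _ ≤ δ * (τ ^ 2 * K) * H := by gcongr
      _ = _ := by ring
  exact le_of_mul_le_mul_right h1 (by positivity)
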